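/- Let $n>1$ and let $K\subset\mathbb R^n$ be a non-empty closed convex set (possibly unbounded). Write $-K=\{-y : y\in K\}$ and let $$g(x)=g_{K,-K}(x):=\left|K\cap(-K+x)\right|\in[0,\infty],\qquad x\in\mathbb R^n,$$ be the cross covariogram of $K$ and $-K$, where $|\cdot|$ denotes $n$-dimensional Lebesgue measure. Assume that $0<g(a)<\infty$ for some $a\in\mathbb R^n$. Then for every $h$ with $0<h<\sup_{x\in\mathbb R^n} g(x)$ (the supremum may be $+\infty$) the level set $$\{x\in\mathbb R^n \mid g(x)\ge h\}$$ is strictly convex, that is, for any two distinct points $x,y$ of the level set and every $t\in(0,1)$, the point $(1-t)x+ty$ lies in the interior of the level set. Moreover, there is at most one point at which $g$ attains its maximum; if $K$ is bounded, then $g$ attains its maximum at exactly one point. -/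

import Mathlib

open MeasureTheory
open scoped ENNReal Pointwise

/-- The cross covariogram `g_{K,L}(x) = |K ∩ (L + x)|` of two subsets of `ℝⁿ`, where `|·|` is
Lebesgue measure. It takes values in `[0, ∞]`, since the sets may be unbounded. -/
noncomputable def crossCovariogram {n : ℕ} (K L : Set (EuclideanSpace ℝ (Fin n)))
    (x : EuclideanSpace ℝ (Fin n)) : ℝ≥0∞ :=
  volume (K ∩ (x +ᵥ L))

/-- The standing hypothesis on a pair of subsets of `ℝⁿ`. -/
structure StandingHypothesis {n : ℕ} (K L : Set (EuclideanSpace ℝ (Fin n))) : Prop where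
  one_lt_dim : 1 < n
  left_nonempty : K.Nonempty
  left_closed : IsClosed K
  left_convex : Convex ℝ K
  right_nonempty : L.Nonempty
  right_closed : IsClosed L
  right_convex : Convex ℝ L
  exists_pos_finite : ∃ a, 0 < crossCovariogram K L a ∧ crossCovariogram K L a < ∞

/-! Write `K_x = K ∩ (x - K)`. It is convex and symmetric about `x/2`, and midpoints of `K_x` and
`K_y` lie in `K_m`, `m = (x+y)/2`, so Brunn–Minkowski gives `g(x) g(y) ≤ g(m)²`. The point is
strictness (`lt_crossCovariogram_midpoint`): if `g(x), g(y) ≥ h > 0` and `g(m) ≤ h`, equality holds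
throughout, and the equality case makes the centred bodies coincide, so `K_y = K_x + v` with `v =
(y-x)/2`. Then `K_x` and `K_x + v` both lie in `K_m`, which has the volume of `K_x`; hence `K_x + v
⊆ K_x`, impossible for a bounded set when `v ≠ 0`.

The equality case (`map_restrict_eq_of_volume_eq`) compares marginals along a functional `u`. If
`α`, `β` are the quantile functions for `A` and `B`, Brunn–Minkowski on half-space slices makes
`(α+β)/2` one for `M`. Prékopa–Leindler with weight `exp u` then reverses Cauchy–Schwarz for `exp
(α/2)` and `exp (β/2)`, so `α - β` is constant; symmetry makes the constant zero, and Hahn–Banach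
turns equal marginals into an inclusion.

Continuity of `g` where it is positive upgrades midpoints to strict convexity. Two maximizers would
have a better midpoint; for bounded `K`, upper semicontinuity gives a maximizer. -/

/-! ### Brunn–Minkowski and Prékopa–Leindler on the line -/

/-- One-dimensional Brunn–Minkowski for sets with a greatest and a least element respectively. -/
theorem volume_add_volume_le_of_isGreatest_isLeast {A B C : Set ℝ}
    (hB : MeasurableSet B) {a b : ℝ} (ha : IsGreatest A a) (hb : IsLeast B b)
    (hC : ∀ x ∈ A, ∀ y ∈ B, (x + y) / 2 ∈ C) :
    volume A + volume B ≤ 2 * volume C := by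
  have key : ∀ (S : Set ℝ) (c : ℝ),
      volume S = 2 * volume ((fun z : ℝ => 2 * z) ⁻¹' ((fun z => z + -c) ⁻¹' S)) := by
    intro S c
    rw [Real.volume_preimage_mul_left two_ne_zero, measure_preimage_add_right, ← mul_assoc]
    have : (2 : ℝ≥0∞) * ENNReal.ofReal |(2 : ℝ)⁻¹| = 1 := by
      rw [abs_of_pos (by norm_num), show (2 : ℝ≥0∞) = ENNReal.ofReal 2 by simp,
        ← ENNReal.ofReal_mul (by norm_num)]
      norm_num
    rw [this, one_mul]
  -- `(A+b)/2` and `(a+B)/2` lie in `C`, and by the extremality of `a` and `b` they meet at most in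
  -- `(a+b)/2`.
  rw [key A b, key B a, ← mul_add]
  gcongr
  rw [← measure_union₀]
  · refine measure_mono ?_
    rintro z (hz | hz)
    · have := hC _ hz _ hb.1
      simpa using this
    · have := hC _ ha.1 _ hz
      simpa using this
  · exact (((measurable_id.add_const _).comp (measurable_const_mul _)) hB).nullMeasurableSet
  · refine measure_mono_null (t := {(a + b) / 2}) ?_ Real.volume_singleton
    rintro z ⟨h1, h2⟩
    have h1' := ha.2 h1
    have h2' := hb.2 h2
    simp only [Set.mem_singleton_iff]
    linarith

/-- One-dimensional Brunn–Minkowski inequality, in midpoint form. -/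
theorem volume_add_volume_le {A B C : Set ℝ} (hA : MeasurableSet A)
    (hB : MeasurableSet B) (hA0 : A.Nonempty) (hB0 : B.Nonempty)
    (hC : ∀ x ∈ A, ∀ y ∈ B, (x + y) / 2 ∈ C) :
    volume A + volume B ≤ 2 * volume C := by
  obtain ⟨a, ha⟩ := hA0
  obtain ⟨b, hb⟩ := hB0
  -- Splitting the strict inequality below needs both volumes nonzero; a null set is replaced by one
  -- of its points.
  by_cases h0 : volume A = 0
  · rw [h0]
    rw [zero_add]
    by_contra! hlt
    obtain ⟨L, hL, hLc, hlt'⟩ := hB.exists_lt_isCompact hlt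
    have hL0 : L.Nonempty := by
      rw [Set.nonempty_iff_ne_empty]; rintro rfl; simp at hlt'
    have := volume_add_volume_le_of_isGreatest_isLeast (A := {a}) (C := C)
      hLc.measurableSet isGreatest_singleton (hLc.isLeast_sInf hL0)
      (by rintro _ rfl y hy; exact hC _ ha _ (hL hy))
    simp only [measure_singleton, zero_add] at this
    exact absurd this (not_le.2 hlt')
  by_cases h1 : volume B = 0
  · rw [h1, add_zero]
    by_contra! hlt
    obtain ⟨L, hL, hLc, hlt'⟩ := hA.exists_lt_isCompact hlt
    have hL0 : L.Nonempty := by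
      rw [Set.nonempty_iff_ne_empty]; rintro rfl; simp at hlt'
    have := volume_add_volume_le_of_isGreatest_isLeast (B := {b}) (C := C)
      (measurableSet_singleton _) (hLc.isGreatest_sSup hL0) isLeast_singleton
      (by rintro x hx _ rfl; exact hC _ (hL hx) _ hb)
    simp only [measure_singleton, add_zero] at this
    exact absurd this (not_le.2 hlt')
  by_contra! hlt
  obtain ⟨r, hr, s, hs, hrs⟩ := ENNReal.exists_lt_add_of_lt_add hlt h0 h1
  obtain ⟨L, hL, hLc, hrL⟩ := hA.exists_lt_isCompact hr
  obtain ⟨M, hM, hMc, hsM⟩ := hB.exists_lt_isCompact hs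
  have hL0 : L.Nonempty := by
    rw [Set.nonempty_iff_ne_empty]; rintro rfl; simp at hrL
  have hM0 : M.Nonempty := by
    rw [Set.nonempty_iff_ne_empty]; rintro rfl; simp at hsM
  have := volume_add_volume_le_of_isGreatest_isLeast (C := C) hMc.measurableSet
    (hLc.isGreatest_sSup hL0) (hMc.isLeast_sInf hM0) (fun x hx y hy => hC _ (hL hx) _ (hM hy))
  exact absurd (hrs.trans_le ((add_le_add hrL.le hsM.le).trans this)) (lt_irrefl _)

/-- Integrates Brunn–Minkowski for the superlevel sets over the level `t`. The common supremum 1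
makes those of `f` and `g` nonempty for every `t < 1` and empty from 1 on. -/
theorem lintegral_add_le_of_sup_eq_one {f g h : ℝ → ℝ} (hf : Measurable f) (hg : Measurable g)
    (hh : Measurable h) (hf0 : 0 ≤ f) (hg0 : 0 ≤ g) (hh0 : 0 ≤ h)
    (hf1 : ∀ x, f x ≤ 1) (hg1 : ∀ x, g x ≤ 1)
    (hfs : ∀ t < 1, ∃ x, t < f x) (hgs : ∀ t < 1, ∃ x, t < g x)
    (H : ∀ x y, f x * g y ≤ h ((x + y) / 2) ^ 2) :
    (∫⁻ x, ENNReal.ofReal (f x)) + ∫⁻ x, ENNReal.ofReal (g x)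
      ≤ 2 * ∫⁻ x, ENNReal.ofReal (h x) := by
  rw [lintegral_eq_lintegral_meas_lt volume (.of_forall hf0) hf.aemeasurable,
    lintegral_eq_lintegral_meas_lt volume (.of_forall hg0) hg.aemeasurable,
    lintegral_eq_lintegral_meas_lt volume (.of_forall hh0) hh.aemeasurable]
  have hm : Measurable fun t : ℝ => volume {a | t < f a} := by
    refine Antitone.measurable fun s t hst => measure_mono fun x hx => ?_
    exact lt_of_le_of_lt hst hx
  rw [← lintegral_add_left hm, ← lintegral_const_mul' _ _ (by simp)]
  refine setLIntegral_mono' measurableSet_Ioi fun t ht => ?_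
  have ht : 0 < t := ht
  rcases lt_or_ge t 1 with h1 | h1
  · refine volume_add_volume_le (measurableSet_lt measurable_const hf)
      (measurableSet_lt measurable_const hg) (hfs t h1) (hgs t h1) fun x hx y hy => ?_
    have hx : t < f x := hx
    have hy : t < g y := hy
    have : t ^ 2 < h ((x + y) / 2) ^ 2 := by
      refine lt_of_lt_of_le ?_ (H x y)
      nlinarith
    exact lt_of_pow_lt_pow_left₀ 2 (hh0 _) this
  · have e1 : {a | t < f a} = ∅ := by
      ext x; simpa using (hf1 x).trans h1
    have e2 : {a | t < g a} = ∅ := by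
      ext x; simpa using (hg1 x).trans h1
    simp [e1, e2]

theorem ENNReal.mul_le_sq_of_add_le_two_mul {a b c : ℝ≥0∞} (h : a + b ≤ 2 * c) :
    a * b ≤ c ^ 2 := by
  by_cases hc : c = ∞
  · simp [hc]
  have hab : a + b ≠ ∞ := ne_top_of_le_ne_top (ENNReal.mul_ne_top (by simp) hc) h
  rw [ENNReal.add_ne_top] at hab
  lift a to NNReal using hab.1
  lift b to NNReal using hab.2
  lift c to NNReal using hc
  norm_cast at h ⊢
  rw [← NNReal.coe_le_coe] at h ⊢
  push_cast at h ⊢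
  nlinarith [sq_nonneg ((a : ℝ) - b), a.2, b.2, c.2, pow_le_pow_left₀ (add_nonneg a.2 b.2) h 2]

/-- Dividing `f`, `g`, `h` by `F`, `G`, `√(FG)` preserves the hypothesis and normalizes both
suprema; AM–GM then turns the sum into a product. -/
theorem lintegral_mul_le_sq_of_bounded {f g h : ℝ → ℝ} (hf : Measurable f) (hg : Measurable g)
    (hh : Measurable h) (hf0 : 0 ≤ f) (hg0 : 0 ≤ g) (hh0 : 0 ≤ h)
    (hfb : BddAbove (Set.range f)) (hgb : BddAbove (Set.range g))
    (H : ∀ x y, f x * g y ≤ h ((x + y) / 2) ^ 2) :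
    (∫⁻ x, ENNReal.ofReal (f x)) * (∫⁻ x, ENNReal.ofReal (g x))
      ≤ (∫⁻ x, ENNReal.ofReal (h x)) ^ 2 := by
  rcases (Real.iSup_nonneg hf0).eq_or_lt with hF | hF
  · have : ∀ x, f x ≤ 0 := fun x => hF ▸ le_ciSup hfb x
    simp [ENNReal.ofReal_of_nonpos (this _)]
  rcases (Real.iSup_nonneg hg0).eq_or_lt with hG | hG
  · have : ∀ x, g x ≤ 0 := fun x => hG ▸ le_ciSup hgb x
    simp [ENNReal.ofReal_of_nonpos (this _)]
  set F := ⨆ x, f x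
  set G := ⨆ x, g x
  have hS : 0 < √(F * G) := Real.sqrt_pos.2 (mul_pos hF hG)
  have scale : ∀ (k : ℝ → ℝ) (c : ℝ), 0 < c →
      ∫⁻ x, ENNReal.ofReal (k x) = ENNReal.ofReal c * ∫⁻ x, ENNReal.ofReal (k x / c) := by
    intro k c hc
    rw [← lintegral_const_mul' _ _ (by simp)]
    refine lintegral_congr fun x => ?_
    rw [← ENNReal.ofReal_mul hc.le, mul_div_cancel₀ _ hc.ne']
  have key := lintegral_add_le_of_sup_eq_one (f := fun x => f x / F) (g := fun x => g x / G)
    (h := fun x => h x / √(F * G)) (hf.div_const _) (hg.div_const _) (hh.div_const _)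
    (fun x => div_nonneg (hf0 x) hF.le) (fun x => div_nonneg (hg0 x) hG.le)
    (fun x => div_nonneg (hh0 x) hS.le)
    (fun x => (div_le_one hF).2 (le_ciSup hfb x)) (fun x => (div_le_one hG).2 (le_ciSup hgb x))
    (fun t ht => by
      obtain ⟨x, hx⟩ := exists_lt_of_lt_ciSup (show t * F < ⨆ x, f x from by
        change t * F < F; nlinarith)
      exact ⟨x, (lt_div_iff₀ hF).2 hx⟩)
    (fun t ht => by
      obtain ⟨x, hx⟩ := exists_lt_of_lt_ciSup (show t * G < ⨆ x, g x from by
        change t * G < G; nlinarith)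
      exact ⟨x, (lt_div_iff₀ hG).2 hx⟩)
    (fun x y => by
      rw [div_mul_div_comm, div_pow, Real.sq_sqrt (mul_pos hF hG).le]
      gcongr
      exact H x y)
  have := ENNReal.mul_le_sq_of_add_le_two_mul key
  rw [scale f F hF, scale g G hG, scale h _ hS, mul_mul_mul_comm, mul_pow,
    ← ENNReal.ofReal_pow hS.le, Real.sq_sqrt (mul_pos hF hG).le, ENNReal.ofReal_mul hF.le]
  gcongr

/-! ### Prékopa–Leindler in `ℝⁿ` -/

/-- The multiplicative midpoint Prékopa–Leindler inequality for a measure. -/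
def PrekopaLeindler {E : Type*} [AddCommGroup E] [Module ℝ E] [MeasurableSpace E]
    (μ : Measure E) : Prop :=
  ∀ f g h : E → ℝ≥0∞, Measurable f → Measurable g → Measurable h →
    (∀ x y, f x * g y ≤ h ((2⁻¹ : ℝ) • (x + y)) ^ 2) →
    (∫⁻ x, f x ∂μ) * (∫⁻ x, g x ∂μ) ≤ (∫⁻ x, h x ∂μ) ^ 2

theorem lintegral_eq_iSup_min {E : Type*} [MeasurableSpace E] (μ : Measure E) {f : E → ℝ≥0∞}
    (hf : Measurable f) : ∫⁻ x, f x ∂μ = ⨆ N : ℕ, ∫⁻ x, min (f x) N ∂μ := by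
  rw [← lintegral_iSup (fun N => hf.min measurable_const)]
  · refine lintegral_congr fun x => ?_
    rw [← inf_iSup_eq, ENNReal.iSup_natCast, inf_top_eq]
  · intro M N h x
    exact min_le_min_left _ (by exact_mod_cast h)

/-- Truncating all three functions at one common level preserves the hypothesis; monotone
convergence removes the truncation. -/
theorem prekopaLeindler_real : PrekopaLeindler (volume : Measure ℝ) := by
  intro f g h hf hg hh H
  rw [lintegral_eq_iSup_min _ hf, lintegral_eq_iSup_min _ hg, ENNReal.iSup_mul]
  refine iSup_le fun N => ?_
  rw [ENNReal.mul_iSup]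
  refine iSup_le fun M => ?_
  have hnt : ∀ (k : ℝ → ℝ≥0∞) x, min (k x) ((max N M : ℕ) : ℝ≥0∞) ≠ ∞ := fun k x =>
    ne_top_of_le_ne_top (ENNReal.natCast_ne_top _) (min_le_right _ _)
  have hbd : ∀ k : ℝ → ℝ≥0∞,
      BddAbove (Set.range fun x => (min (k x) ((max N M : ℕ) : ℝ≥0∞)).toReal) := by
    rintro k
    refine ⟨((max N M : ℕ) : ℝ), ?_⟩
    rintro _ ⟨x, rfl⟩
    have := ENNReal.toReal_mono (ENNReal.natCast_ne_top (max N M))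
      (min_le_right (k x) ((max N M : ℕ) : ℝ≥0∞))
    simpa only [ENNReal.toReal_natCast] using this
  have key := lintegral_mul_le_sq_of_bounded
    (hf.min measurable_const).ennreal_toReal (hg.min measurable_const).ennreal_toReal
    (hh.min measurable_const).ennreal_toReal
    (fun x => ENNReal.toReal_nonneg) (fun x => ENNReal.toReal_nonneg)
    (fun x => ENNReal.toReal_nonneg) (hbd f) (hbd g) (fun x y => by
      rw [← ENNReal.toReal_mul, ← ENNReal.toReal_pow]
      refine ENNReal.toReal_mono (ENNReal.pow_ne_top (hnt h _)) ?_
      rcases min_choice (h ((x + y) / 2)) ((max N M : ℕ) : ℝ≥0∞) with e | e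
      · rw [e]
        refine (mul_le_mul' (min_le_left _ _) (min_le_left _ _)).trans ((H x y).trans_eq ?_)
        rw [smul_eq_mul, div_eq_inv_mul]
      · rw [e, sq]
        exact mul_le_mul' (min_le_right _ _) (min_le_right _ _))
  simp only [ENNReal.ofReal_toReal (hnt _ _)] at key
  refine le_trans (mul_le_mul' ?_ ?_) (key.trans ?_)
  · gcongr; simp
  · gcongr; simp
  · gcongr; simp

/-- Tensorization: the inequality for `ν` on fibres is the hypothesis of the inequality for `μ` on
the fibre integrals. -/
theorem PrekopaLeindler.prod {E F : Type*} [AddCommGroup E] [Module ℝ E] [MeasurableSpace E]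
    [AddCommGroup F] [Module ℝ F] [MeasurableSpace F] {μ : Measure E} {ν : Measure F}
    [SFinite ν] (hμ : PrekopaLeindler μ) (hν : PrekopaLeindler ν) :
    PrekopaLeindler (μ.prod ν) := by
  intro f g h hf hg hh H
  rw [lintegral_prod _ hf.aemeasurable, lintegral_prod _ hg.aemeasurable,
    lintegral_prod _ hh.aemeasurable]
  refine hμ _ _ _ hf.lintegral_prod_right' hg.lintegral_prod_right' hh.lintegral_prod_right' ?_
  intro x x'
  exact hν _ _ _ (hf.comp measurable_prodMk_left) (hg.comp measurable_prodMk_left)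
    (hh.comp measurable_prodMk_left) fun y y' => H (x, y) (x', y')

theorem PrekopaLeindler.of_measurePreserving {E F : Type*} [AddCommGroup E] [Module ℝ E]
    [MeasurableSpace E] [AddCommGroup F] [Module ℝ F] [MeasurableSpace F] {μ : Measure E}
    {ν : Measure F} (hμ : PrekopaLeindler μ) (e : E → F) (he : MeasurePreserving e μ ν)
    (hadd : ∀ x y, e ((2⁻¹ : ℝ) • (x + y)) = (2⁻¹ : ℝ) • (e x + e y)) : PrekopaLeindler ν := by
  intro f g h hf hg hh H
  rw [← he.lintegral_comp hf, ← he.lintegral_comp hg, ← he.lintegral_comp hh]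
  refine hμ _ _ _ (hf.comp he.measurable) (hg.comp he.measurable) (hh.comp he.measurable) ?_
  intro x y
  simpa only [Function.comp, hadd] using H (e x) (e y)

theorem prekopaLeindler_pi (n : ℕ) : PrekopaLeindler (volume : Measure (Fin n → ℝ)) := by
  induction n with
  | zero =>
    intro f g h hf hg hh H
    rw [Measure.volume_pi_eq_dirac 0, lintegral_dirac, lintegral_dirac, lintegral_dirac]
    simpa using H 0 0
  | succ n ih =>
    refine (prekopaLeindler_real.prod ih).of_measurePreserving _
      (volume_preserving_piFinSuccAbove (fun _ : Fin (n + 1) => ℝ) 0).symm ?_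
    intro x y
    ext i
    refine Fin.cases ?_ (fun j => ?_) i <;> simp [MeasurableEquiv.piFinSuccAbove, mul_add]

/-- The multiplicative midpoint Prékopa–Leindler inequality for Lebesgue measure on `ℝⁿ`. -/
theorem prekopaLeindler_euclideanSpace (n : ℕ) :
    PrekopaLeindler (volume : Measure (EuclideanSpace ℝ (Fin n))) :=
  (prekopaLeindler_pi n).of_measurePreserving _ (PiLp.volume_preserving_toLp (Fin n))
    fun x y => by simp

/-! ### Quantile functions and equality in Cauchy–Schwarz -/

open Filter Topology in
/-- Existence of upper quantiles of a finite measure on the line. -/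
theorem exists_upper_quantile (ν : Measure ℝ) [IsFiniteMeasure ν] :
    ∃ q : ℝ → ℝ, AntitoneOn q (Set.Ioo 0 (ν.real Set.univ)) ∧
      ∀ s ∈ Set.Ioo 0 (ν.real Set.univ),
        s ≤ ν.real (Set.Ici (q s)) ∧ ν.real (Set.Ioi (q s)) ≤ s := by
  have hne : ∀ s < ν.real Set.univ, {t | s ≤ ν.real (Set.Ici t)}.Nonempty := by
    intro s hs
    have hm : Monotone fun n : ℕ => Set.Ici (-(n : ℝ)) := fun m n h =>
      Set.Ici_subset_Ici.2 (neg_le_neg (by exact_mod_cast h))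
    have hu : ⋃ n : ℕ, Set.Ici (-(n : ℝ)) = Set.univ := by
      refine Set.eq_univ_of_forall fun x => ?_
      obtain ⟨n, hn⟩ := exists_nat_ge (-x)
      exact Set.mem_iUnion.2 ⟨n, by simp only [Set.mem_Ici]; linarith⟩
    have h1 := (ENNReal.tendsto_toReal (measure_ne_top ν _)).comp
      (tendsto_measure_iUnion_atTop (μ := ν) hm)
    rw [hu] at h1
    obtain ⟨n, hn⟩ := (h1.eventually_const_lt hs).exists
    exact ⟨_, hn.le⟩
  have hbdd : ∀ s > 0, BddAbove {t | s ≤ ν.real (Set.Ici t)} := by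
    intro s hs
    have hm : Antitone fun n : ℕ => Set.Ici (n : ℝ) := fun m n h =>
      Set.Ici_subset_Ici.2 (by exact_mod_cast h)
    have hu : ⋂ n : ℕ, Set.Ici (n : ℝ) = ∅ := by
      refine Set.eq_empty_of_forall_notMem fun x hx => ?_
      obtain ⟨n, hn⟩ := exists_nat_gt x
      exact absurd (Set.mem_iInter.1 hx n) (not_le.2 hn)
    have h1 := (ENNReal.tendsto_toReal (measure_ne_top ν _)).comp
      (tendsto_measure_iInter_atTop (μ := ν) (fun n => measurableSet_Ici.nullMeasurableSet) hm
        ⟨0, measure_ne_top _ _⟩)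
    rw [hu, measure_empty, ENNReal.toReal_zero] at h1
    obtain ⟨n, hn⟩ := (h1.eventually_lt_const hs).exists
    refine ⟨n, fun t ht => ?_⟩
    by_contra! hlt
    have : ν.real (Set.Ici t) ≤ ν.real (Set.Ici (n : ℝ)) :=
      measureReal_mono (Set.Ici_subset_Ici.2 hlt.le)
    exact absurd (le_trans ht this) (not_le.2 hn)
  -- The last level above which mass `s` remains; continuity of the measure from above and below
  -- gives the two bounds.
  refine ⟨fun s => sSup {t | s ≤ ν.real (Set.Ici t)}, ?_, ?_⟩
  · intro s hs s' hs' hss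
    exact csSup_le_csSup (hbdd s hs.1) (hne s' hs'.2) fun t ht => hss.trans ht
  · intro s hs
    set q := sSup {t | s ≤ ν.real (Set.Ici t)} with hq
    have hu := tendsto_one_div_add_atTop_nhds_zero_nat (𝕜 := ℝ)
    constructor
    · have hm : Antitone fun n : ℕ => Set.Ici (q - 1 / ((n : ℝ) + 1)) := fun m n h =>
        Set.Ici_subset_Ici.2 (sub_le_sub_left (Nat.one_div_le_one_div h) _)
      have hi : ⋂ n : ℕ, Set.Ici (q - 1 / ((n : ℝ) + 1)) = Set.Ici q := by
        ext x
        simp only [Set.mem_iInter, Set.mem_Ici]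
        constructor
        · intro h
          have := le_of_tendsto' (hu.const_sub q) h
          simpa using this
        · intro h n
          have : (0 : ℝ) < 1 / ((n : ℝ) + 1) := Nat.one_div_pos_of_nat
          linarith
      have h1 := (ENNReal.tendsto_toReal (measure_ne_top ν _)).comp
        (tendsto_measure_iInter_atTop (μ := ν) (fun n => measurableSet_Ici.nullMeasurableSet) hm
          ⟨0, measure_ne_top _ _⟩)
      rw [hi] at h1
      refine ge_of_tendsto' h1 fun n => ?_
      obtain ⟨t, ht, hlt⟩ := exists_lt_of_lt_csSup (hne s hs.2)
        (show q - 1 / ((n : ℝ) + 1) < q from sub_lt_self _ Nat.one_div_pos_of_nat)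
      exact le_trans ht (measureReal_mono (Set.Ici_subset_Ici.2 hlt.le))
    · have hm : Monotone fun n : ℕ => Set.Ici (q + 1 / ((n : ℝ) + 1)) := fun m n h =>
        Set.Ici_subset_Ici.2 (add_le_add_right (Nat.one_div_le_one_div h) _)
      have hi : ⋃ n : ℕ, Set.Ici (q + 1 / ((n : ℝ) + 1)) = Set.Ioi q := by
        ext x
        simp only [Set.mem_iUnion, Set.mem_Ici, Set.mem_Ioi]
        constructor
        · rintro ⟨n, hn⟩
          have : (0 : ℝ) < 1 / ((n : ℝ) + 1) := Nat.one_div_pos_of_nat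
          linarith
        · intro h
          obtain ⟨n, hn⟩ := exists_nat_one_div_lt (sub_pos.2 h)
          exact ⟨n, by linarith⟩
      have h1 := (ENNReal.tendsto_toReal (measure_ne_top ν _)).comp
        (tendsto_measure_iUnion_atTop (μ := ν) hm)
      rw [hi] at h1
      refine le_of_tendsto' h1 fun n => ?_
      by_contra! hlt
      have h2 : q + 1 / ((n : ℝ) + 1) ≤ q := le_csSup (hbdd s hs.1) hlt.le
      have : (0 : ℝ) < 1 / ((n : ℝ) + 1) := Nat.one_div_pos_of_nat
      linarith

/-- An upper quantile function transports the uniform measure to the given measure. -/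
theorem map_eq_of_upper_quantile (ν : Measure ℝ) [IsFiniteMeasure ν] {q : ℝ → ℝ}
    (hq : AEMeasurable q (volume.restrict (Set.Ioo 0 (ν.real Set.univ))))
    (H : ∀ s ∈ Set.Ioo 0 (ν.real Set.univ),
        s ≤ ν.real (Set.Ici (q s)) ∧ ν.real (Set.Ioi (q s)) ≤ s) :
    Measure.map q (volume.restrict (Set.Ioo 0 (ν.real Set.univ))) = ν := by
  refine Measure.ext_of_Ici _ _ fun t => ?_
  rw [Measure.map_apply_of_aemeasurable hq measurableSet_Ici,
    Measure.restrict_apply₀ (hq.nullMeasurableSet_preimage measurableSet_Ici),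
    ← ofReal_measureReal (measure_ne_top ν _)]
  have hc : ν.real (Set.Ici t) ≤ ν.real Set.univ := measureReal_mono (Set.subset_univ _)
  -- With `c = ν [t, ∞)`, the set where `t ≤ q s` lies between `(0, c)` and `(0, c]`.
  refine le_antisymm ?_ ?_
  · calc _ ≤ volume (Set.Ioc 0 (ν.real (Set.Ici t))) := by
          refine measure_mono ?_
          rintro s ⟨h1, h2⟩
          exact ⟨h2.1, (H s h2).1.trans (measureReal_mono (Set.Ici_subset_Ici.2 h1))⟩
      _ = _ := by rw [Real.volume_Ioc, sub_zero]
  · calc _ = volume (Set.Ioo 0 (ν.real (Set.Ici t))) := by rw [Real.volume_Ioo, sub_zero]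
      _ ≤ _ := by
          refine measure_mono fun s hs => ?_
          have hs' : s ∈ Set.Ioo 0 (ν.real Set.univ) := ⟨hs.1, hs.2.trans_le hc⟩
          refine ⟨?_, hs'⟩
          change t ≤ q s
          by_contra! hlt
          have : ν.real (Set.Ici t) ≤ ν.real (Set.Ioi (q s)) :=
            measureReal_mono (Set.Ici_subset_Ioi.2 hlt)
          exact absurd (hs.2.trans_le (this.trans (H s hs').2)) (lt_irrefl _)

/-- The equality case of the Cauchy–Schwarz inequality for integrals. -/
theorem ae_mul_eq_mul_of_integral_sq_mul_le {X : Type*} [MeasurableSpace X] {μ : Measure X}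
    {f k : X → ℝ} (hf : Integrable (fun x => f x ^ 2) μ) (hk : Integrable (fun x => k x ^ 2) μ)
    (hfk : Integrable (fun x => f x * k x) μ)
    (H : (∫ x, f x ^ 2 ∂μ) * (∫ x, k x ^ 2 ∂μ) ≤ (∫ x, f x * k x ∂μ) ^ 2) :
    ∀ᵐ x ∂μ, (∫ x, k x ^ 2 ∂μ) * f x = (∫ x, f x * k x ∂μ) * k x := by
  set P := ∫ x, f x ^ 2 ∂μ
  set Q := ∫ x, k x ^ 2 ∂μ
  set R := ∫ x, f x * k x ∂μ
  have hQ : 0 ≤ Q := integral_nonneg fun x => sq_nonneg _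
  have he : (fun x => (Q * f x - R * k x) ^ 2) =
      fun x => Q ^ 2 * f x ^ 2 - 2 * Q * R * (f x * k x) + R ^ 2 * k x ^ 2 := by
    ext x; ring
  have hI : Integrable (fun x => (Q * f x - R * k x) ^ 2) μ := by
    rw [he]
    exact ((hf.const_mul _).sub (hfk.const_mul _)).add (hk.const_mul _)
  have hv : ∫ x, (Q * f x - R * k x) ^ 2 ∂μ = Q ^ 2 * P - 2 * Q * R * R + R ^ 2 * Q := by
    rw [he, integral_add (by exact (hf.const_mul _).sub (hfk.const_mul _)) (hk.const_mul _),
      integral_sub (hf.const_mul _) (hfk.const_mul _), integral_const_mul, integral_const_mul,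
      integral_const_mul]
  -- The integral equals `Q (P Q - R²)`, which `H` makes nonpositive.
  have h0 : ∫ x, (Q * f x - R * k x) ^ 2 ∂μ = 0 := by
    refine le_antisymm ?_ (integral_nonneg fun x => sq_nonneg _)
    rw [hv]
    nlinarith
  rw [integral_eq_zero_iff_of_nonneg (fun x => sq_nonneg _) hI] at h0
  filter_upwards [h0] with x hx
  have : Q * f x - R * k x = 0 := by simpa using hx
  linarith

/-! ### Equality in Brunn–Minkowski for symmetric bodies -/

section

variable {n : ℕ}

local notation "E" => EuclideanSpace ℝ (Fin n)

/-- Serves twice: `w = 1` gives Brunn–Minkowski, and `w = exp u` is the weight in the equality case.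
-/
theorem setLIntegral_mul_le_sq {A B M : Set E} (hA : MeasurableSet A) (hB : MeasurableSet B)
    (hM : MeasurableSet M) (hAB : ∀ x ∈ A, ∀ y ∈ B, (2⁻¹ : ℝ) • (x + y) ∈ M) {w : E → ℝ≥0∞}
    (hw : Measurable w) (hww : ∀ x y, w x * w y ≤ w ((2⁻¹ : ℝ) • (x + y)) ^ 2) :
    (∫⁻ x in A, w x) * (∫⁻ x in B, w x) ≤ (∫⁻ x in M, w x) ^ 2 := by
  rw [← lintegral_indicator hA, ← lintegral_indicator hB, ← lintegral_indicator hM]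
  refine prekopaLeindler_euclideanSpace n _ _ _ (hw.indicator hA) (hw.indicator hB)
    (hw.indicator hM) fun x y => ?_
  by_cases hx : x ∈ A
  · by_cases hy : y ∈ B
    · rw [Set.indicator_of_mem hx, Set.indicator_of_mem hy, Set.indicator_of_mem (hAB x hx y hy)]
      exact hww x y
    · simp [hy]
  · simp [hx]

/-- The multiplicative midpoint Brunn–Minkowski inequality. -/
theorem volume_mul_volume_le_sq {A B M : Set E} (hA : MeasurableSet A) (hB : MeasurableSet B)
    (hM : MeasurableSet M) (hAB : ∀ x ∈ A, ∀ y ∈ B, (2⁻¹ : ℝ) • (x + y) ∈ M) :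
    volume A * volume B ≤ volume M ^ 2 := by
  simpa using setLIntegral_mul_le_sq hA hB hM hAB (w := fun _ => 1) measurable_const (by simp)

theorem volume_real_le_of_midpoint {A B M : Set E} (hA : MeasurableSet A) (hB : MeasurableSet B)
    (hM : MeasurableSet M) (hMf : volume M ≠ ∞)
    (hAB : ∀ x ∈ A, ∀ y ∈ B, (2⁻¹ : ℝ) • (x + y) ∈ M) {s : ℝ} (hs : 0 ≤ s)
    (hsA : s ≤ volume.real A) (hsB : s ≤ volume.real B) : s ≤ volume.real M := by
  have h := ENNReal.toReal_mono (ENNReal.pow_ne_top hMf) (volume_mul_volume_le_sq hA hB hM hAB)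
  rw [ENNReal.toReal_mul, ENNReal.toReal_pow] at h
  change volume.real A * volume.real B ≤ volume.real M ^ 2 at h
  have : s ^ 2 ≤ volume.real M ^ 2 := by nlinarith
  exact le_of_sq_le_sq this measureReal_nonneg

theorem integral_clm_eq_zero_of_symmetric {A : Set E} (hA : MeasurableSet A)
    (hsymm : ∀ x ∈ A, -x ∈ A) (u : E →L[ℝ] ℝ) : ∫ x in A, u x = 0 := by
  have hmem : ∀ x, -x ∈ A ↔ x ∈ A := fun x => ⟨fun h => by simpa using hsymm _ h, hsymm x⟩
  have h := integral_neg_eq_self (A.indicator fun x => u x) volume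
  have h2 : (fun x => A.indicator (fun x => u x) (-x)) = fun x => - A.indicator (fun x => u x) x := by
    ext x
    by_cases hx : x ∈ A
    · simp [hx, (hmem x).2 hx]
    · simp [hx, (hmem x).not.2 hx]
  rw [h2, integral_neg] at h
  rw [← integral_indicator hA]
  linarith

/-- Equality in the Brunn–Minkowski inequality for symmetric compact sets of equal volume:
all one-dimensional marginals agree. -/
theorem map_restrict_eq_of_volume_eq {A B M : Set E} (hA : IsCompact A) (hB : IsCompact B)
    (hM : IsCompact M) (hAB : ∀ x ∈ A, ∀ y ∈ B, (2⁻¹ : ℝ) • (x + y) ∈ M)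
    (hAs : ∀ x ∈ A, -x ∈ A) (hBs : ∀ x ∈ B, -x ∈ B) (h0 : 0 < volume A)
    (hBA : volume B = volume A) (hMA : volume M = volume A) (u : E →L[ℝ] ℝ) :
    Measure.map u (volume.restrict A) = Measure.map u (volume.restrict B) := by
  have hu : Measurable u := u.continuous.measurable
  have hfin : ∀ {S : Set E}, IsCompact S → IsFiniteMeasure (volume.restrict S) := fun hS =>
    ⟨by simpa using hS.measure_lt_top⟩
  have := hfin hA
  have := hfin hB
  have := hfin hM
  set h := volume.real A with hh
  have hpos : 0 < h := ENNReal.toReal_pos h0.ne' hA.measure_lt_top.ne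
  have hBh : volume.real B = h := by simp [Measure.real, hBA, hh]
  have hMh : volume.real M = h := by simp [Measure.real, hMA, hh]
  have hν : ∀ (S : Set E) (T : Set ℝ), MeasurableSet T →
      (Measure.map u (volume.restrict S)).real T = volume.real (S ∩ u ⁻¹' T) := by
    intro S T hT
    rw [Measure.real, Measure.map_apply hu hT, Measure.restrict_apply (hu hT), Set.inter_comm]
    rfl
  have hνu : ∀ S : Set E, (Measure.map u (volume.restrict S)).real Set.univ = volume.real S := by
    intro S
    rw [hν S _ MeasurableSet.univ, Set.preimage_univ, Set.inter_univ]
  obtain ⟨α, hαm, hα⟩ := exists_upper_quantile (Measure.map u (volume.restrict A))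
  obtain ⟨β, hβm, hβ⟩ := exists_upper_quantile (Measure.map u (volume.restrict B))
  rw [hνu, ← hh] at hαm hα
  rw [hνu, hBh] at hβm hβ
  set lam := volume.restrict (Set.Ioo 0 h) with hlam
  have : IsFiniteMeasure lam := ⟨by simp [hlam]⟩
  have hαa : AEMeasurable α lam := aemeasurable_restrict_of_antitoneOn measurableSet_Ioo hαm
  have hβa : AEMeasurable β lam := aemeasurable_restrict_of_antitoneOn measurableSet_Ioo hβm
  have mapA : Measure.map α lam = Measure.map u (volume.restrict A) := by
    have := map_eq_of_upper_quantile (Measure.map u (volume.restrict A)) (q := α)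
    rw [hνu, ← hh] at this
    exact this hαa hα
  have mapB : Measure.map β lam = Measure.map u (volume.restrict B) := by
    have := map_eq_of_upper_quantile (Measure.map u (volume.restrict B)) (q := β)
    rw [hνu, hBh] at this
    exact this hβa hβ
  have hga : AEMeasurable (fun s => 2⁻¹ * (α s + β s)) lam := (hαa.add hβa).const_mul _
  -- mass below a level, from mass above it
  have compl : ∀ {S : Set E}, IsCompact S → volume.real S = h → ∀ t : ℝ,
      volume.real (S ∩ u ⁻¹' Set.Iic t) = h - volume.real (S ∩ u ⁻¹' Set.Ioi t) := by
    intro S hS hSh t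
    have h1 := measureReal_inter_add_sdiff (μ := volume) (s := S) (hu (measurableSet_Iic (a := t)))
      hS.measure_lt_top.ne
    have h2 : S \ u ⁻¹' Set.Iic t = S ∩ u ⁻¹' Set.Ioi t := by
      ext x; simp
    rw [h2] at h1
    linarith
  -- Slices above `α s` and `β s` bound the upper mass of `M` from below; slices below them bound
  -- its lower mass. Equal total volumes make these the two quantile inequalities.
  have mapM : Measure.map (fun s => 2⁻¹ * (α s + β s)) lam
      = Measure.map u (volume.restrict M) := by
    have := map_eq_of_upper_quantile (Measure.map u (volume.restrict M))
      (q := fun s => 2⁻¹ * (α s + β s))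
    rw [hνu, hMh] at this
    refine this hga fun s hs => ?_
    have hα' := hα s hs
    have hβ' := hβ s hs
    rw [hν _ _ measurableSet_Ici, hν _ _ measurableSet_Ioi] at hα' hβ' ⊢
    constructor
    · refine volume_real_le_of_midpoint (hA.measurableSet.inter (hu measurableSet_Ici))
        (hB.measurableSet.inter (hu measurableSet_Ici))
        (hM.measurableSet.inter (hu measurableSet_Ici))
        (measure_ne_top_of_subset Set.inter_subset_left hM.measure_lt_top.ne) ?_ hs.1.le
        hα'.1 hβ'.1
      rintro x ⟨hx, hx'⟩ y ⟨hy, hy'⟩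
      refine ⟨hAB x hx y hy, ?_⟩
      simp only [Set.mem_preimage, Set.mem_Ici, map_smul, map_add, smul_eq_mul] at hx' hy' ⊢
      linarith
    · have h1 : h - s ≤ volume.real (M ∩ u ⁻¹' Set.Iic (2⁻¹ * (α s + β s))) := by
        refine volume_real_le_of_midpoint (A := A ∩ u ⁻¹' Set.Iic (α s))
          (B := B ∩ u ⁻¹' Set.Iic (β s)) (hA.measurableSet.inter (hu measurableSet_Iic))
          (hB.measurableSet.inter (hu measurableSet_Iic))
          (hM.measurableSet.inter (hu measurableSet_Iic))
          (measure_ne_top_of_subset Set.inter_subset_left hM.measure_lt_top.ne) ?_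
          (sub_nonneg.2 hs.2.le) ?_ ?_
        · rintro x ⟨hx, hx'⟩ y ⟨hy, hy'⟩
          refine ⟨hAB x hx y hy, ?_⟩
          simp only [Set.mem_preimage, Set.mem_Iic, map_smul, map_add, smul_eq_mul] at hx' hy' ⊢
          linarith
        · rw [compl hA hh.symm]; linarith [hα'.2]
        · rw [compl hB hBh]; linarith [hβ'.2]
      rw [compl hM hMh] at h1
      linarith
  have transfer : ∀ {S : Set E} {q : ℝ → ℝ}, IsCompact S → AEMeasurable q lam →
      Measure.map q lam = Measure.map u (volume.restrict S) → ∀ φ : ℝ → ℝ, Continuous φ →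
      Integrable (fun s => φ (q s)) lam ∧ ∫ s, φ (q s) ∂lam = ∫ x in S, φ (u x) := by
    intro S q hS hq hmap φ hφ
    have hint : IntegrableOn (fun x => φ (u x)) S :=
      (hφ.comp u.continuous).continuousOn.integrableOn_compact hS
    constructor
    · refine (integrable_map_measure hφ.aestronglyMeasurable hq).1 ?_
      rw [hmap]
      exact (integrable_map_measure hφ.aestronglyMeasurable hu.aemeasurable).2 hint
    · rw [← integral_map hq hφ.aestronglyMeasurable, hmap,
        integral_map hu.aemeasurable hφ.aestronglyMeasurable]
  -- In terms of quantiles this reads `∫ exp α · ∫ exp β ≤ (∫ exp ((α+β)/2))²`, the reverse of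
  -- Cauchy–Schwarz.
  have PL : (∫ x in A, Real.exp (u x)) * (∫ x in B, Real.exp (u x))
      ≤ (∫ x in M, Real.exp (u x)) ^ 2 := by
    have hme : Measurable fun x => ENNReal.ofReal (Real.exp (u x)) :=
      (Real.measurable_exp.comp hu).ennreal_ofReal
    have key := setLIntegral_mul_le_sq hA.measurableSet hB.measurableSet hM.measurableSet hAB hme
      (fun x y => by
        rw [← ENNReal.ofReal_mul (Real.exp_nonneg _), ← ENNReal.ofReal_pow (Real.exp_nonneg _),
          ← Real.exp_add, ← Real.exp_nat_mul]
        refine ENNReal.ofReal_le_ofReal (Real.exp_le_exp.2 (le_of_eq ?_))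
        simp only [map_smul, map_add, smul_eq_mul]
        push_cast
        ring)
    have conv : ∀ {S : Set E}, IsCompact S → ∫⁻ x in S, ENNReal.ofReal (Real.exp (u x))
        = ENNReal.ofReal (∫ x in S, Real.exp (u x)) := fun hS =>
      (ofReal_integral_eq_lintegral_ofReal
        ((Real.continuous_exp.comp u.continuous).continuousOn.integrableOn_compact hS)
        (.of_forall fun x => Real.exp_nonneg _)).symm
    have hnn : ∀ S : Set E, 0 ≤ ∫ x in S, Real.exp (u x) := fun S =>
      integral_nonneg fun x => Real.exp_nonneg _
    rw [conv hA, conv hB, conv hM, ← ENNReal.ofReal_mul (hnn A), ← ENNReal.ofReal_pow (hnn M)] at key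
    exact (ENNReal.ofReal_le_ofReal_iff (sq_nonneg _)).1 key
  obtain ⟨iA, eA⟩ := transfer hA hαa mapA Real.exp Real.continuous_exp
  obtain ⟨iB, eB⟩ := transfer hB hβa mapB Real.exp Real.continuous_exp
  obtain ⟨iM, eM⟩ := transfer hM hga mapM Real.exp Real.continuous_exp
  rw [← eA, ← eB, ← eM] at PL
  have sqe : ∀ t : ℝ, Real.exp t = Real.exp (2⁻¹ * t) ^ 2 := fun t => by
    rw [← Real.exp_nat_mul]; congr 1; push_cast; ring
  have mule : ∀ s t : ℝ, Real.exp (2⁻¹ * (s + t)) = Real.exp (2⁻¹ * s) * Real.exp (2⁻¹ * t) :=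
    fun s t => by rw [← Real.exp_add, mul_add]
  simp only [mule] at iM PL
  simp only [fun s => sqe (α s)] at iA PL
  simp only [fun s => sqe (β s)] at iB PL
  have hcs := ae_mul_eq_mul_of_integral_sq_mul_le iA iB iM PL
  have hlam0 : lam ≠ 0 := by
    rw [hlam, Ne, Measure.restrict_eq_zero, Real.volume_Ioo]
    simpa using hpos
  have hposint : ∀ f : ℝ → ℝ, (∀ s, 0 < f s) → Integrable f lam → 0 < ∫ s, f s ∂lam := by
    intro f hf hfi
    rw [integral_pos_iff_support_of_nonneg (fun s => (hf s).le) hfi]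
    have : Function.support f = Set.univ := Set.eq_univ_of_forall fun s => (hf s).ne'
    rw [this]
    exact (Measure.measure_univ_pos).2 hlam0
  have hQ := hposint _ (fun s => by positivity) iB
  have hR := hposint _ (fun s => by positivity) iM
  set Q := ∫ s, Real.exp (2⁻¹ * β s) ^ 2 ∂lam
  set R := ∫ s, Real.exp (2⁻¹ * α s) * Real.exp (2⁻¹ * β s) ∂lam
  have hshift : ∀ᵐ s ∂lam, α s = β s + 2 * (Real.log R - Real.log Q) := by
    filter_upwards [hcs] with s hs
    have := congrArg Real.log hs
    rw [Real.log_mul hQ.ne' (Real.exp_ne_zero _), Real.log_mul hR.ne' (Real.exp_ne_zero _),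
      Real.log_exp, Real.log_exp] at this
    linarith
  set c := 2 * (Real.log R - Real.log Q)
  obtain ⟨jA, fA⟩ := transfer hA hαa mapA id continuous_id
  obtain ⟨jB, fB⟩ := transfer hB hβa mapB id continuous_id
  simp only [id] at jA fA jB fB
  rw [integral_clm_eq_zero_of_symmetric hA.measurableSet hAs] at fA
  rw [integral_clm_eq_zero_of_symmetric hB.measurableSet hBs] at fB
  -- Both marginals have mean zero by symmetry.
  have hc : c = 0 := by
    rw [integral_congr_ae hshift, integral_add jB (integrable_const c), fB, zero_add,
      integral_const, smul_eq_mul] at fA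
    have : lam.real Set.univ ≠ 0 := by
      rw [Measure.real, ENNReal.toReal_ne_zero]
      exact ⟨(Measure.measure_univ_pos.2 hlam0).ne', measure_ne_top _ _⟩
    exact (mul_eq_zero.1 fA).resolve_left this
  rw [← mapA, ← mapB]
  refine Measure.map_congr ?_
  filter_upwards [hshift] with s hs
  rw [hs, hc, add_zero]

theorem Convex.volume_inter_pos {A U : Set E} (hA : Convex ℝ A) (hi : (interior A).Nonempty)
    (hU : IsOpen U) {p : E} (hp : p ∈ A) (hpU : p ∈ U) : 0 < volume (A ∩ U) := by
  have h1 : p ∈ closure (interior A) := by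
    rw [hA.closure_interior_eq_closure_of_nonempty_interior hi]
    exact subset_closure hp
  obtain ⟨q, hq⟩ := mem_closure_iff.1 h1 U hU hpU
  refine lt_of_lt_of_le ((hU.inter isOpen_interior).measure_pos volume ⟨q, hq⟩) (measure_mono ?_)
  rintro x ⟨hx, hx'⟩
  exact ⟨interior_subset hx', hx⟩

/-- A set without interior lies in its own frontier, which is null for a convex set. -/
theorem Convex.interior_nonempty_of_volume_pos {A : Set E} (hA : Convex ℝ A)
    (h : 0 < volume A) : (interior A).Nonempty := by
  rw [Set.nonempty_iff_ne_empty]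
  intro he
  have h1 : volume A ≤ volume (frontier A) := measure_mono fun x hx => by
    rw [frontier, he, Set.sdiff_empty]
    exact subset_closure hx
  rw [hA.addHaar_frontier volume] at h1
  exact absurd h1 (not_le.2 h)

theorem Convex.subset_of_volume_le {A C : Set E} (hC : Convex ℝ C)
    (hi : (interior C).Nonempty) (hA : IsClosed A) (hAC : A ⊆ C) (hfin : volume A ≠ ∞)
    (hle : volume C ≤ volume A) : C ⊆ A := by
  intro p hp
  by_contra hpA
  have h1 := hC.volume_inter_pos hi hA.isOpen_compl hp hpA
  rw [← Set.sdiff_eq, measure_sdiff hAC hA.measurableSet.nullMeasurableSet hfin,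
    tsub_eq_zero_of_le hle] at h1
  exact lt_irrefl _ h1

/-- Equality in the Brunn–Minkowski inequality for symmetric convex bodies of equal volume. -/
theorem subset_of_volume_midpoint_eq {A B M : Set E} (hA : IsCompact A) (hB : IsCompact B)
    (hM : IsCompact M) (hAB : ∀ x ∈ A, ∀ y ∈ B, (2⁻¹ : ℝ) • (x + y) ∈ M)
    (hAs : ∀ x ∈ A, -x ∈ A) (hBs : ∀ x ∈ B, -x ∈ B) (hAc : Convex ℝ A) (hBc : Convex ℝ B)
    (h0 : 0 < volume A) (hBA : volume B = volume A) (hMA : volume M = volume A) : A ⊆ B := by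
  intro p hp
  by_contra hpB
  -- The half-space `u > c` misses `B` but carries positive volume of `A`, so the marginals along
  -- `u` differ.
  obtain ⟨u, c, hu1, hu2⟩ := geometric_hahn_banach_closed_point hBc hB.isClosed hpB
  have hm := map_restrict_eq_of_volume_eq hA hB hM hAB hAs hBs h0 hBA hMA u
  have hu : Measurable u := u.continuous.measurable
  have h1 := congrArg (fun ν : Measure ℝ => ν (Set.Ioi c)) hm
  simp only [Measure.map_apply hu measurableSet_Ioi,
    Measure.restrict_apply (hu (measurableSet_Ioi (a := c)))] at h1
  have h2 : u ⁻¹' Set.Ioi c ∩ B = ∅ := by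
    refine Set.eq_empty_of_forall_notMem ?_
    rintro x ⟨hx, hxB⟩
    exact lt_asymm hx (hu1 x hxB)
  rw [h2, measure_empty, Set.inter_comm] at h1
  exact (hAc.volume_inter_pos (hAc.interior_nonempty_of_volume_pos h0)
    (isOpen_Ioi.preimage u.continuous) hp hu2).ne' h1

end

/-! ### The sections `K ∩ (x - K)` and their volumes -/

section

variable {n : ℕ}

local notation "E" => EuclideanSpace ℝ (Fin n)

/-- If `A` contains a ball of radius `r` about `p` and a far point `q`, it contains the ball of
radius `r/2` about their midpoint. Finite volume forbids this far out, since the volume of `A`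
outside large balls tends to zero. -/
theorem Convex.isBounded_of_volume_ne_top {A : Set E} (hA : Convex ℝ A)
    (hi : (interior A).Nonempty) (hc : IsClosed A) (hfin : volume A ≠ ∞) :
    Bornology.IsBounded A := by
  obtain ⟨p, hp⟩ := hi
  obtain ⟨r, hr, hball⟩ := Metric.isOpen_iff.1 isOpen_interior p hp
  have hball : Metric.ball p r ⊆ A := hball.trans interior_subset
  have hm : Antitone fun k : ℕ => A \ Metric.closedBall p k := fun j k h =>
    Set.sdiff_subset_sdiff_right (Metric.closedBall_subset_closedBall (by exact_mod_cast h))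
  have hempty : ⋂ k : ℕ, A \ Metric.closedBall p k = ∅ := by
    refine Set.eq_empty_of_forall_notMem fun x hx => ?_
    obtain ⟨k, hk⟩ := exists_nat_ge (dist x p)
    exact (Set.mem_iInter.1 hx k).2 hk
  have ht := tendsto_measure_iInter_atTop (μ := volume)
    (fun k : ℕ => (hc.measurableSet.diff
      (Metric.isClosed_closedBall (x := p) (ε := (k : ℝ))).measurableSet).nullMeasurableSet) hm
    ⟨0, ne_top_of_le_ne_top hfin (measure_mono Set.sdiff_subset)⟩
  rw [hempty, measure_empty] at ht
  have hvpos : 0 < volume (Metric.ball (0 : E) (r / 2)) :=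
    Metric.measure_ball_pos _ _ (half_pos hr)
  obtain ⟨k, hk⟩ := (ht.eventually_lt_const hvpos).exists
  refine (Metric.isBounded_closedBall (x := p) (r := 2 * k + r)).subset fun q hq => ?_
  rw [Metric.mem_closedBall]
  by_contra! hlt
  refine absurd hk (not_lt.2 ?_)
  rw [← Measure.addHaar_ball_center volume ((2⁻¹ : ℝ) • (p + q))]
  refine measure_mono fun z hz => ⟨?_, ?_⟩
  · have hz' : (2 : ℝ) • z - q ∈ Metric.ball p r := by
      rw [Metric.mem_ball, dist_eq_norm] at hz ⊢
      have : (2 : ℝ) • z - q - p = (2 : ℝ) • (z - (2⁻¹ : ℝ) • (p + q)) := by module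
      rw [this, norm_smul, Real.norm_of_nonneg (by norm_num)]
      linarith
    have := hA (hball hz') hq (a := 2⁻¹) (b := 2⁻¹) (by norm_num) (by norm_num) (by norm_num)
    convert this using 1
    module
  · rw [Metric.mem_closedBall, not_le]
    rw [Metric.mem_ball] at hz
    have h1 : dist q p = 2 * dist ((2⁻¹ : ℝ) • (p + q)) p := by
      rw [dist_eq_norm, dist_eq_norm]
      have : (2⁻¹ : ℝ) • (p + q) - p = (2⁻¹ : ℝ) • (q - p) := by module
      rw [this, norm_smul, Real.norm_of_nonneg (by norm_num)]
      ring
    have h2 := dist_triangle ((2⁻¹ : ℝ) • (p + q)) z p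
    rw [dist_comm _ z] at h2
    linarith

theorem mem_inter_vadd_neg {K : Set E} {x p : E} :
    p ∈ K ∩ (x +ᵥ -K) ↔ p ∈ K ∧ x - p ∈ K := by
  rw [Set.mem_inter_iff, Set.mem_vadd_set_iff_neg_vadd_mem, Set.mem_neg, vadd_eq_add, neg_add,
    neg_neg, sub_eq_add_neg]

variable {K : Set (EuclideanSpace ℝ (Fin n))}

theorem combo_mem_inter_vadd_neg (hK : Convex ℝ K) {x y p q : E} (hp : p ∈ K ∩ (x +ᵥ -K))
    (hq : q ∈ K ∩ (y +ᵥ -K)) {a b : ℝ} (ha : 0 ≤ a) (hb : 0 ≤ b) (hab : a + b = 1) :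
    a • p + b • q ∈ K ∩ ((a • x + b • y) +ᵥ -K) := by
  rw [mem_inter_vadd_neg] at *
  refine ⟨hK hp.1 hq.1 ha hb hab, ?_⟩
  convert hK hp.2 hq.2 ha hb hab using 1
  module

theorem convex_inter_vadd_neg (hK : Convex ℝ K) (x : E) : Convex ℝ (K ∩ (x +ᵥ -K)) := by
  intro p hp q hq a b ha hb hab
  have := combo_mem_inter_vadd_neg hK hp hq ha hb hab
  rwa [← add_smul, hab, one_smul] at this

theorem isClosed_inter_vadd_neg (hK : IsClosed K) (x : E) : IsClosed (K ∩ (x +ᵥ -K)) :=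
  hK.inter (hK.neg.vadd x)

/-- The section at `a • x + b • y` contains the copy of the section at `x` scaled by `a` and
translated by `b • q`. -/
theorem mul_crossCovariogram_le (hK : Convex ℝ K) {x y q : E} (hq : q ∈ K ∩ (y +ᵥ -K))
    {a b : ℝ} (ha : 0 ≤ a) (hb : 0 ≤ b) (hab : a + b = 1) :
    ENNReal.ofReal (a ^ n) * crossCovariogram K (-K) x
      ≤ crossCovariogram K (-K) (a • x + b • y) := by
  have h1 : volume ((b • q) +ᵥ (a • (K ∩ (x +ᵥ -K))))
      = ENNReal.ofReal (a ^ n) * crossCovariogram K (-K) x := by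
    rw [measure_vadd, Measure.addHaar_smul, finrank_euclideanSpace_fin, abs_of_nonneg (by positivity)]
    rfl
  rw [← h1]
  refine measure_mono ?_
  rintro _ ⟨_, ⟨p, hp, rfl⟩, rfl⟩
  have := combo_mem_inter_vadd_neg hK hp hq ha hb hab
  simpa only [vadd_eq_add, add_comm] using this

/-- For `p` interior to the section at `a`, the point `p + (y - a)` works: its reflection `y - (p +
(y - a))` is `a - p`. -/
theorem exists_forall_nonempty_inter_vadd_neg (hK : Convex ℝ K) {a : E}
    (ha : 0 < crossCovariogram K (-K) a) :
    ∃ r > 0, ∀ y, ‖y - a‖ < r → (K ∩ (y +ᵥ -K)).Nonempty := by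
  obtain ⟨p, hp⟩ := (convex_inter_vadd_neg hK a).interior_nonempty_of_volume_pos ha
  obtain ⟨r, hr, hball⟩ := Metric.isOpen_iff.1 isOpen_interior p hp
  refine ⟨r, hr, fun y hy => ⟨p + (y - a), ?_⟩⟩
  have h1 := mem_inter_vadd_neg.1 (interior_subset hp)
  have h2 : p + (y - a) ∈ K ∩ (a +ᵥ -K) :=
    interior_subset (hball (by rwa [Metric.mem_ball, dist_eq_norm, add_sub_cancel_left]))
  rw [mem_inter_vadd_neg] at h2 ⊢
  refine ⟨h2.1, ?_⟩
  convert h1.2 using 1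
  abel

/-- The point `a` lies strictly between `x` and a point slightly beyond `a` with nonempty section,
so an infinite value at `x` would force one at `a`. -/
theorem crossCovariogram_ne_top (hK : Convex ℝ K) {a : E} (ha : 0 < crossCovariogram K (-K) a)
    (ha' : crossCovariogram K (-K) a < ∞) (x : E) : crossCovariogram K (-K) x ≠ ∞ := by
  intro hx
  obtain ⟨r, hr, H⟩ := exists_forall_nonempty_inter_vadd_neg hK ha
  obtain ⟨e, he, hlt⟩ : ∃ e > 0, e * ‖a - x‖ < r := by
    refine ⟨r / (‖a - x‖ + 1), by positivity, ?_⟩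
    rw [div_mul_eq_mul_div, div_lt_iff₀ (by positivity)]
    nlinarith [norm_nonneg (a - x)]
  obtain ⟨q, hq⟩ := H (a + e • (a - x)) (by
    rwa [add_sub_cancel_left, norm_smul, Real.norm_of_nonneg he.le])
  have h1 := mul_crossCovariogram_le hK (x := x) hq (a := e / (1 + e)) (b := 1 / (1 + e))
    (by positivity) (by positivity) (by field_simp; ring)
  have h2 : (e / (1 + e)) • x + (1 / (1 + e)) • (a + e • (a - x)) = a := by
    have h3 : (1 : ℝ) + e ≠ 0 := by positivity
    match_scalars <;> field_simp
    ring
  rw [h2, hx, ENNReal.mul_top (by rw [Ne, ENNReal.ofReal_eq_zero, not_le]; positivity)] at h1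
  exact absurd (h1.trans_lt ha') (lt_irrefl _)

theorem isCompact_inter_vadd_neg (hK : Convex ℝ K) (hKc : IsClosed K) {x : E}
    (h0 : 0 < crossCovariogram K (-K) x) (h1 : crossCovariogram K (-K) x ≠ ∞) :
    IsCompact (K ∩ (x +ᵥ -K)) :=
  Metric.isCompact_of_isClosed_isBounded (isClosed_inter_vadd_neg hKc x)
    ((convex_inter_vadd_neg hK x).isBounded_of_volume_ne_top
      ((convex_inter_vadd_neg hK x).interior_nonempty_of_volume_pos h0)
      (isClosed_inter_vadd_neg hKc x) h1)

/-- The covariogram strictly exceeds `h` at the midpoint of two points of the level set. -/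
theorem lt_crossCovariogram_midpoint (hK : Convex ℝ K) (hKc : IsClosed K)
    (hfin : ∀ x, crossCovariogram K (-K) x ≠ ∞) {h : ℝ≥0∞} (h0 : 0 < h) {x y : E} (hxy : x ≠ y)
    (hx : h ≤ crossCovariogram K (-K) x) (hy : h ≤ crossCovariogram K (-K) y) :
    h < crossCovariogram K (-K) ((2⁻¹ : ℝ) • (x + y)) := by
  by_contra! hle
  set m := (2⁻¹ : ℝ) • (x + y) with hm
  have hAB : ∀ p ∈ K ∩ (x +ᵥ -K), ∀ q ∈ K ∩ (y +ᵥ -K),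
      (2⁻¹ : ℝ) • (p + q) ∈ K ∩ (m +ᵥ -K) := by
    intro p hp q hq
    have := combo_mem_inter_vadd_neg hK hp hq (a := 2⁻¹) (b := 2⁻¹) (by norm_num) (by norm_num)
      (by norm_num)
    rwa [← smul_add, ← smul_add] at this
  have hmeas : ∀ z, MeasurableSet (K ∩ (z +ᵥ -K)) := fun z =>
    (isClosed_inter_vadd_neg hKc z).measurableSet
  have hBM : crossCovariogram K (-K) x * crossCovariogram K (-K) y
      ≤ crossCovariogram K (-K) m ^ 2 :=
    volume_mul_volume_le_sq (hmeas x) (hmeas y) (hmeas m) hAB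
  have htop : h ≠ ∞ := ne_top_of_le_ne_top (hfin x) hx
  have e1 : crossCovariogram K (-K) x = h := by
    refine le_antisymm ?_ hx
    have : crossCovariogram K (-K) x * h ≤ h * h := by
      rw [← sq]
      exact (mul_le_mul_right hy _).trans (hBM.trans (pow_le_pow_left' hle 2))
    exact (ENNReal.mul_le_mul_iff_left h0.ne' htop).1 this
  have e2 : crossCovariogram K (-K) y = h := by
    refine le_antisymm ?_ hy
    have : h * crossCovariogram K (-K) y ≤ h * h := by
      rw [← sq]
      exact (mul_le_mul_left hx _).trans (hBM.trans (pow_le_pow_left' hle 2))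
    exact (ENNReal.mul_le_mul_iff_right h0.ne' htop).1 this
  have e3 : crossCovariogram K (-K) m = h := by
    refine le_antisymm hle ?_
    rw [e1, e2, ← sq] at hBM
    exact (ENNReal.pow_le_pow_left_iff two_ne_zero).1 hBM
  have cx := isCompact_inter_vadd_neg hK hKc (h0.trans_eq e1.symm) (hfin x)
  have cy := isCompact_inter_vadd_neg hK hKc (h0.trans_eq e2.symm) (hfin y)
  have cm := isCompact_inter_vadd_neg hK hKc (h0.trans_eq e3.symm) (hfin m)
  -- The section at `z` is invariant under `p ↦ z - p`; translating by `-z/2` centres it at the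
  -- origin.
  have hsymm : ∀ z : E, ∀ p ∈ (-((2⁻¹ : ℝ) • z)) +ᵥ (K ∩ (z +ᵥ -K)),
      -p ∈ (-((2⁻¹ : ℝ) • z)) +ᵥ (K ∩ (z +ᵥ -K)) := by
    rintro z _ ⟨p, hp, rfl⟩
    rw [mem_inter_vadd_neg] at hp
    refine ⟨z - p, mem_inter_vadd_neg.2 ⟨hp.2, by rw [sub_sub_cancel]; exact hp.1⟩, ?_⟩
    simp only [vadd_eq_add]
    module
  have hsub := subset_of_volume_midpoint_eq (cx.vadd (-((2⁻¹ : ℝ) • x)))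
    (cy.vadd (-((2⁻¹ : ℝ) • y))) (cm.vadd (-((2⁻¹ : ℝ) • m)))
    (by
      rintro _ ⟨p, hp, rfl⟩ _ ⟨q, hq, rfl⟩
      refine ⟨_, hAB p hp q hq, ?_⟩
      simp only [vadd_eq_add, hm]
      module)
    (hsymm x) (hsymm y) ((convex_inter_vadd_neg hK x).vadd _)
    ((convex_inter_vadd_neg hK y).vadd _)
    (by rw [measure_vadd]; exact h0.trans_eq e1.symm)
    (by rw [measure_vadd, measure_vadd]; exact e2.trans e1.symm)
    (by rw [measure_vadd, measure_vadd]; exact e3.trans e1.symm)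
  -- The difference of the two centres of symmetry.
  set v := (2⁻¹ : ℝ) • (y - x) with hv
  have hshift : ∀ p ∈ K ∩ (x +ᵥ -K), p + v ∈ K ∩ (y +ᵥ -K) := by
    intro p hp
    have := hsub (Set.vadd_mem_vadd_set hp)
    rw [Set.mem_vadd_set_iff_neg_vadd_mem, neg_neg, vadd_eq_add, vadd_eq_add] at this
    convert this using 1
    rw [hv]
    module
  -- The reflection of `p + v` in the section at `y` is `y - (p + v) = m - p`.
  have hxm : K ∩ (x +ᵥ -K) ⊆ K ∩ (m +ᵥ -K) := by
    intro p hp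
    refine mem_inter_vadd_neg.2 ⟨hp.1, ?_⟩
    convert (mem_inter_vadd_neg.1 (hshift p hp)).2 using 1
    rw [hv, hm]
    module
  have hvm : ∀ p ∈ K ∩ (x +ᵥ -K), p + v ∈ K ∩ (m +ᵥ -K) := by
    intro p hp
    refine mem_inter_vadd_neg.2 ⟨(hshift p hp).1, ?_⟩
    convert (mem_inter_vadd_neg.1 hp).2 using 1
    rw [hv, hm]
    module
  have hmx : K ∩ (m +ᵥ -K) ⊆ K ∩ (x +ᵥ -K) :=
    (convex_inter_vadd_neg hK m).subset_of_volume_le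
      ((convex_inter_vadd_neg hK m).interior_nonempty_of_volume_pos (h0.trans_eq e3.symm))
      cx.isClosed hxm (hfin x) (e3.trans e1.symm).le
  obtain ⟨p, hp⟩ : (K ∩ (x +ᵥ -K)).Nonempty :=
    nonempty_of_measure_ne_zero (h0.trans_eq e1.symm).ne'
  have hiter : ∀ k : ℕ, p + (k : ℝ) • v ∈ K ∩ (x +ᵥ -K) := by
    intro k
    induction k with
    | zero => simpa using hp
    | succ k ih =>
      convert hmx (hvm _ ih) using 1
      push_cast
      module
  obtain ⟨R, hR⟩ := cx.isBounded.subset_closedBall p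
  have hv0 : 0 < ‖v‖ := by
    rw [norm_pos_iff, hv]
    exact smul_ne_zero (by norm_num) (sub_ne_zero.2 hxy.symm)
  obtain ⟨k, hk⟩ := exists_nat_gt (R / ‖v‖)
  have h1 := hR (hiter k)
  rw [Metric.mem_closedBall, dist_eq_norm, add_sub_cancel_left, norm_smul, Real.norm_natCast] at h1
  rw [div_lt_iff₀ hv0] at hk
  linarith

/-! ### Continuity where `g` is positive, and strict convexity of level sets -/

open Filter Topology in
theorem exists_lt_ofReal_pow_mul {c d : ℝ≥0∞} (h : c < d) (n : ℕ) :
    ∃ e ∈ Set.Ioo (0 : ℝ) 1, c < ENNReal.ofReal ((1 - e) ^ n) * d := by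
  have h1 : Tendsto (fun e : ℝ => ENNReal.ofReal ((1 - e) ^ n)) (𝓝[>] 0) (𝓝 1) := by
    have : Continuous fun e : ℝ => ENNReal.ofReal ((1 - e) ^ n) :=
      ENNReal.continuous_ofReal.comp (by fun_prop)
    simpa using (this.tendsto 0).mono_left nhdsWithin_le_nhds
  have h2 := ENNReal.Tendsto.mul_const (b := d) h1 (Or.inl one_ne_zero)
  rw [one_mul] at h2
  obtain ⟨e, he, he'⟩ := ((h2.eventually_const_lt h).and
    (Ioo_mem_nhdsGT (zero_lt_one' ℝ))).exists
  exact ⟨e, he', he⟩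

-- Near `m`, the point `x` has weight `e` towards a point with nonempty section on the ray from `m`,
-- and symmetrically with `x` and `m` exchanged. The scaling bound then applies in both directions.
open Filter Topology in
theorem eventually_mul_crossCovariogram_le (hK : Convex ℝ K) {m : E}
    (hm : 0 < crossCovariogram K (-K) m) {e : ℝ} (he : e ∈ Set.Ioo (0 : ℝ) 1) :
    ∀ᶠ x in 𝓝 m,
      ENNReal.ofReal ((1 - e) ^ n) * crossCovariogram K (-K) m ≤ crossCovariogram K (-K) x ∧
      ENNReal.ofReal ((1 - e) ^ n) * crossCovariogram K (-K) x ≤ crossCovariogram K (-K) m := by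
  obtain ⟨r, hr, H⟩ := exists_forall_nonempty_inter_vadd_neg hK hm
  have he0 : e ≠ 0 := he.1.ne'
  filter_upwards [Metric.ball_mem_nhds m (mul_pos he.1 hr)] with x hx
  rw [Metric.mem_ball, dist_eq_norm] at hx
  have hx' : e⁻¹ * ‖x - m‖ < r := by
    rw [inv_mul_lt_iff₀ he.1]; exact hx
  constructor
  · obtain ⟨q, hq⟩ := H (m + e⁻¹ • (x - m)) (by
      rwa [add_sub_cancel_left, norm_smul, Real.norm_of_nonneg (inv_nonneg.2 he.1.le)])
    have := mul_crossCovariogram_le hK (x := m) hq (sub_nonneg.2 he.2.le) he.1.le (by ring)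
    convert this using 2
    match_scalars <;> field_simp
    ring
  · obtain ⟨q, hq⟩ := H (x + e⁻¹ • (m - x)) (by
      have : x + e⁻¹ • (m - x) - m = (1 - e⁻¹) • (x - m) := by module
      rw [this, norm_smul]
      refine lt_of_le_of_lt ?_ hx'
      gcongr
      rw [Real.norm_eq_abs, abs_of_nonpos (sub_nonpos.2 ((one_le_inv₀ he.1).2 he.2.le))]
      linarith)
    have := mul_crossCovariogram_le hK (x := x) hq (sub_nonneg.2 he.2.le) he.1.le (by ring)
    convert this using 2
    match_scalars <;> field_simp
    ring

open Filter Topology in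
theorem eventually_lt_crossCovariogram (hK : Convex ℝ K) {m : E} {h : ℝ≥0∞}
    (hm : h < crossCovariogram K (-K) m) : ∀ᶠ x in 𝓝 m, h < crossCovariogram K (-K) x := by
  obtain ⟨e, he, hlt⟩ := exists_lt_ofReal_pow_mul hm n
  filter_upwards [eventually_mul_crossCovariogram_le hK (zero_le.trans_lt hm) he] with x hx
  exact hlt.trans_le hx.1

open Filter Topology in
theorem eventually_crossCovariogram_lt (hK : Convex ℝ K) {m : E} {h : ℝ≥0∞}
    (hm0 : 0 < crossCovariogram K (-K) m) (hm : crossCovariogram K (-K) m < h) :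
    ∀ᶠ x in 𝓝 m, crossCovariogram K (-K) x < h := by
  obtain ⟨e, he, hlt⟩ := exists_lt_ofReal_pow_mul hm n
  filter_upwards [eventually_mul_crossCovariogram_le hK hm0 he] with x hx
  by_contra! hle
  exact absurd (hlt.trans_le ((mul_le_mul_right hle _).trans hx.2)) (lt_irrefl _)

/-- A point of a segment with endpoints in a midpoint-closed set is within any prescribed distance
of a point of the set. -/
theorem exists_dist_le_of_midpoint_mem {S : Set E}
    (hS : ∀ x ∈ S, ∀ y ∈ S, (2⁻¹ : ℝ) • (x + y) ∈ S) (k : ℕ) :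
    ∀ x ∈ S, ∀ y ∈ S, ∀ t ∈ Set.Icc (0 : ℝ) 1,
      ∃ w ∈ S, ‖(1 - t) • x + t • y - w‖ ≤ ‖y - x‖ / 2 ^ k := by
  induction k with
  | zero =>
    intro x hx y hy t ht
    refine ⟨x, hx, ?_⟩
    have : (1 - t) • x + t • y - x = t • (y - x) := by module
    rw [this, norm_smul, Real.norm_of_nonneg ht.1, pow_zero, div_one]
    nlinarith [norm_nonneg (y - x), ht.2]
  | succ k ih =>
    intro x hx y hy t ht
    have hm := hS x hx y hy
    rcases le_total t 2⁻¹ with h | h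
    · obtain ⟨w, hw, hle⟩ := ih x hx _ hm (2 * t) ⟨by linarith [ht.1], by linarith⟩
      refine ⟨w, hw, ?_⟩
      have e1 : (1 - 2 * t) • x + (2 * t) • (2⁻¹ : ℝ) • (x + y) = (1 - t) • x + t • y := by module
      have e2 : (2⁻¹ : ℝ) • (x + y) - x = (2⁻¹ : ℝ) • (y - x) := by module
      rw [e1, e2, norm_smul, Real.norm_of_nonneg (by norm_num)] at hle
      refine hle.trans_eq ?_
      rw [pow_succ]
      field_simp
    · obtain ⟨w, hw, hle⟩ := ih _ hm y hy (2 * t - 1) ⟨by linarith, by linarith [ht.2]⟩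
      refine ⟨w, hw, ?_⟩
      have e1 : (1 - (2 * t - 1)) • (2⁻¹ : ℝ) • (x + y) + (2 * t - 1) • y
          = (1 - t) • x + t • y := by module
      have e2 : y - (2⁻¹ : ℝ) • (x + y) = (2⁻¹ : ℝ) • (y - x) := by module
      rw [e1, e2, norm_smul, Real.norm_of_nonneg (by norm_num)] at hle
      refine hle.trans_eq ?_
      rw [pow_succ]
      field_simp

theorem strictConvex_level_set (hK : Convex ℝ K) (hKc : IsClosed K)
    (hfin : ∀ x, crossCovariogram K (-K) x ≠ ∞) {h : ℝ≥0∞} (h0 : 0 < h) :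
    StrictConvex ℝ {x | h ≤ crossCovariogram K (-K) x} := by
  set S := {x | h ≤ crossCovariogram K (-K) x} with hS
  have hint : ∀ x ∈ S, ∀ y ∈ S, x ≠ y → (2⁻¹ : ℝ) • (x + y) ∈ interior S := by
    intro x hx y hy hxy
    rw [mem_interior_iff_mem_nhds]
    filter_upwards [eventually_lt_crossCovariogram hK
      (lt_crossCovariogram_midpoint hK hKc hfin h0 hxy hx hy)] with z hz using hz.le
  have hmid : ∀ x ∈ S, ∀ y ∈ S, (2⁻¹ : ℝ) • (x + y) ∈ S := by
    intro x hx y hy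
    by_cases hxy : x = y
    · subst hxy
      have : (2⁻¹ : ℝ) • (x + x) = x := by module
      rwa [this]
    · exact interior_subset (hint x hx y hy hxy)
  have hconv : Convex ℝ S := by
    rw [convex_iff_forall_pos]
    intro x hx y hy a b ha hb hab
    have hy' : h ≤ crossCovariogram K (-K) y := hy
    obtain ⟨q, hq⟩ : (K ∩ (y +ᵥ -K)).Nonempty :=
      nonempty_of_measure_ne_zero (h0.trans_le hy').ne'
    -- Positivity gives continuity here: a value below `h` would persist in a ball, yet iterated
    -- midpoints in `S` come arbitrarily close.
    have hpos : 0 < crossCovariogram K (-K) (a • x + b • y) := by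
      refine lt_of_lt_of_le ?_ (mul_crossCovariogram_le hK hq ha.le hb.le hab)
      exact ENNReal.mul_pos (by rw [Ne, ENNReal.ofReal_eq_zero, not_le]; positivity)
        (h0.trans_le hx).ne'
    change h ≤ _
    by_contra! hlt
    obtain ⟨r, hr, hball⟩ := Metric.eventually_nhds_iff.1
      (eventually_crossCovariogram_lt hK hpos hlt)
    obtain ⟨k, hk⟩ := pow_unbounded_of_one_lt (‖y - x‖ / r) (one_lt_two (α := ℝ))
    obtain ⟨w, hw, hle⟩ := exists_dist_le_of_midpoint_mem hmid k x hx y hy b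
      ⟨hb.le, by linarith⟩
    have hwlt : ‖y - x‖ / 2 ^ k < r := by
      rw [div_lt_iff₀ hr] at hk
      rw [div_lt_iff₀ (by positivity)]
      linarith
    rw [show (1 : ℝ) - b = a by linarith] at hle
    have := hball (y := w) (by rw [dist_comm, dist_eq_norm]; exact hle.trans_lt hwlt)
    exact absurd (lt_of_lt_of_le this hw) (lt_irrefl _)
  intro x hx y hy hxy a b ha hb hab
  have hm := hint x hx y hy hxy
  obtain rfl : a = 1 - b := by linarith
  -- Any other point of the open segment lies strictly between an endpoint and the interior
  -- midpoint.
  rcases lt_trichotomy b 2⁻¹ with h | h | h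
  · have := hconv.combo_self_interior_mem_interior hx hm (a := 1 - 2 * b) (b := 2 * b)
      (by linarith) (by linarith) (by linarith)
    convert this using 1
    module
  · convert hm using 1
    rw [h]
    module
  · have := hconv.combo_interior_self_mem_interior hm hy (a := 2 - 2 * b) (b := 2 * b - 1)
      (by linarith) (by linarith) (by linarith)
    convert this using 1
    module

/-! ### Existence of a maximizer and the main theorem -/

-- What the section at `y` gains over the section at `x` lies in `(y - K) \ (x - K)`, whose volume
-- tends to zero as `y → x`. This also covers points where `g` vanishes.
open Filter Topology in
theorem upperSemicontinuous_crossCovariogram (hK : IsCompact K) :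
    UpperSemicontinuous (crossCovariogram K (-K)) := by
  intro x c hc
  have hL : IsCompact (x +ᵥ -K) := hK.neg.vadd x
  have h1 := (tendsto_measure_vadd_sdiff_isCompact_isClosed (μ := volume) hL hL.isClosed)
  have h2 : Tendsto (fun y : E => y - x) (𝓝 x) (𝓝 0) := by
    simpa using (continuous_sub_right x).tendsto x
  have h3 := (h1.comp h2).const_add (crossCovariogram K (-K) x)
  rw [add_zero] at h3
  filter_upwards [h3.eventually_lt_const hc] with y hy
  refine lt_of_le_of_lt ?_ hy
  simp only [Function.comp, vadd_vadd, sub_add_cancel]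
  refine (measure_mono fun p hp => ?_).trans (measure_union_le _ _)
  by_cases hpx : p ∈ x +ᵥ -K
  · exact Or.inl ⟨hp.1, hpx⟩
  · exact Or.inr ⟨hp.2, hpx⟩

/-- `g` vanishes off the compact set `K + K`. -/
theorem exists_forall_crossCovariogram_le (hK : IsCompact K) (hne : K.Nonempty) :
    ∃ x, ∀ y, crossCovariogram K (-K) y ≤ crossCovariogram K (-K) x := by
  obtain ⟨x, -, hx⟩ := ((upperSemicontinuous_crossCovariogram hK).upperSemicontinuousOn
    (K + K)).exists_isMaxOn (hne.add hne) (hK.add hK)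
  refine ⟨x, fun y => ?_⟩
  by_cases hy : y ∈ K + K
  · exact hx hy
  · have : K ∩ (y +ᵥ -K) = ∅ := by
      refine Set.eq_empty_of_forall_notMem fun p hp => hy ?_
      rw [mem_inter_vadd_neg] at hp
      exact ⟨p, hp.1, y - p, hp.2, add_sub_cancel _ _⟩
    rw [crossCovariogram, this, measure_empty]
    exact zero_le

end

theorem mainTheorem5 (n : ℕ) (K : Set (EuclideanSpace ℝ (Fin n)))
    (hK : StandingHypothesis K (-K)) :
    (∀ h : ℝ≥0∞, 0 < h → h < ⨆ x, crossCovariogram K (-K) x →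
      StrictConvex ℝ {x | h ≤ crossCovariogram K (-K) x}) ∧
    {x | ∀ y, crossCovariogram K (-K) y ≤ crossCovariogram K (-K) x}.Subsingleton ∧
    (Bornology.IsBounded K →
      ∃! x, ∀ y, crossCovariogram K (-K) y ≤ crossCovariogram K (-K) x) := by
  obtain ⟨a, ha, ha'⟩ := hK.exists_pos_finite
  have hfin := crossCovariogram_ne_top hK.left_convex ha ha'
  have huniq : {x | ∀ y, crossCovariogram K (-K) y ≤ crossCovariogram K (-K) x}.Subsingleton := by
    intro x hx y hy
    by_contra hxy
    exact absurd (hx _) (not_le.2 (lt_crossCovariogram_midpoint hK.left_convex hK.left_closed hfin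
      (ha.trans_le (hx a)) hxy le_rfl (hy x)))
  refine ⟨fun h h0 _ => strictConvex_level_set hK.left_convex hK.left_closed hfin h0, huniq,
    fun hb => ?_⟩
  obtain ⟨x, hx⟩ := exists_forall_crossCovariogram_le
    (Metric.isCompact_of_isClosed_isBounded hK.left_closed hb) hK.left_nonempty
  exact ⟨x, hx, fun y hy => huniq hy hx⟩
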